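/- Let $M$ be a finite-dimensional smooth manifold (Hausdorff, second countable, without boundary). A connection on $M$ is a smooth map $\varphi: TM\times_M TM\to T(TM)$ with $\varphi(\xi,x)\in T_x(TM)$ and $d\pi_x(\varphi(\xi,x))=\xi$ for $\xi,x\in T_pM$, where $\pi:TM\to M$ is the projection (linearity is not required; the covariant derivative is $\nabla_VW=dW(V)-\varphi(V,W)$). A geodesic of $M$ on an interval $J$ (nonempty and not a single point, here and below) is a twice differentiable curve $c:J\to M$ with $\nabla_{c'}c'=0$, i.e. $(c')'=\varphi(c',c')$ as a curve in $T(TM)$. $M$ is geodesically complete if for every $v\in TM$ there is a geodesic $c:\mathbb R\to M$ with $c'(0)=v$. Let $PM=C^\infty([0,1],M)$. A tangent vector of $PM$ at $\gamma$ is a smooth vector field along $\gamma$, so that $T(PM)=P(TM)$ and $T(T(PM))=P(T(TM))$. A curve $\Gamma$ in $PM$ has velocity $V\in T_{\Gamma(s)}(PM)$ at $s$ if for every $f\in C^\infty(M,\mathbb R)$ the curve $\sigma\mapsto f\circ\Gamma(\sigma)$ in $C^\infty([0,1],\mathbb R)$, with the $C^1$ norm $\|\mu\|=\sup_t\max(|\mu(t)|,|\mu'(t)|)$,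 has derivative $df\circ V$ at $s$; likewise for curves in $T(PM)=P(TM)$. In particular $\Gamma'(s)(t)=\partial_s\Gamma(s,t)$, where $\Gamma(s,t)=\Gamma(s)(t)$. The induced connection $\widetilde\nabla$ on $PM$ is given pointwise by $\widetilde\varphi(V,W)(t)=\varphi(V(t),W(t))$ for $V,W\in T_\gamma(PM)$. A geodesic of $PM$ on an interval is a curve $\Gamma$ which has a velocity curve $\Gamma'$ in $T(PM)$, which in turn has velocity $\widetilde\varphi(\Gamma',\Gamma')$ in $T(T(PM))$, i.e. $\widetilde\nabla_{\Gamma'}\Gamma'=0$. $PM$ is geodesically complete if for every $V\in T(PM)$ there is a geodesic $\Gamma:\mathbb R\to PM$ with $\Gamma'(0)=V$. Theorem. (a) A twice differentiable curve $\Gamma:J\to PM$ on an interval $J$ is a geodesic of $\widetilde\nabla$ if and only if for every $t\in[0,1]$ the curve $s\mapsto\Gamma(s,t)$ is a geodesic of $\nabla$ in $M$. (b) If $M$ is geodesically complete with respect to $\nabla$, then $PM$ is geodesically complete with respect to $\widetilde\nabla$. Moreover, for every $V\in T(PM)$ the geodesic $\Gamma:\mathbb R\to PM$ with $\Gamma'(0)=V$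 is unique; every geodesic of $PM$ defined on an interval extends uniquely to a geodesic defined on $\mathbb R$; and for every geodesic $\Gamma:\mathbb R\to PM$ the map $(s,t)\mapsto\Gamma(s,t)$ is smooth on $\mathbb R\times[0,1]$. -/

import Mathlib

open scoped Manifold ContDiff Topology Bundle
open Bundle

noncomputable section

namespace PathGeometry

variable {E : Type*} [NormedAddCommGroup E] [NormedSpace ℝ E]
  {H : Type*} [TopologicalSpace H] (I : ModelWithCorners ℝ E H)
  (M : Type*) [TopologicalSpace M] [ChartedSpace H M]

/-- The path space `P M`: all smooth maps `[0,1] → M`. -/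
abbrev PathSpace : Type _ := ContMDiffMap (𝓡∂ 1) I unitInterval M ∞

/-- The tangent bundle of the path space. A tangent vector of `P M` at `γ` is a smooth vector field
along `γ`, so `T(P M)` is the space of smooth maps `V : [0,1] → TM`, the foot of `V` being the path
`t ↦ π (V t)`. As it is again a path space, `T(T(P M))` is the path space of `T(TM)`. -/
abbrev PathTangentBundle [IsManifold I ∞ M] : Type _ := PathSpace I.tangent (TangentBundle I M)

variable {M}

/-- The tangent space `X_γ = T_γ (P M)`: the smooth vector fields along `γ`. -/
def PathTangentSpace [IsManifold I ∞ M] (γ : PathSpace I M) : Type _ :=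
  {V : PathTangentBundle I M // ∀ t, (V t).proj = γ t}

variable {I}

/-- The value `V t ∈ T_{γ t} M` of a vector field along `γ`. -/
def PathTangentSpace.vec [IsManifold I ∞ M] {γ : PathSpace I M} (V : PathTangentSpace I γ)
    (t : unitInterval) : TangentSpace I (γ t) :=
  V.2 t ▸ (V.1 t).2

theorem PathTangentSpace.mk_vec [IsManifold I ∞ M] {γ : PathSpace I M}
    (V : PathTangentSpace I γ) (t : unitInterval) :
    (⟨γ t, V.vec t⟩ : TangentBundle I M) = V.1 t := by
  have key : ∀ (v : TangentBundle I M) (p : M) (h : v.proj = p),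
      (⟨p, h ▸ v.2⟩ : TangentBundle I M) = v := by
    rintro ⟨q, w⟩ p rfl
    rfl
  exact key _ _ (V.2 t)

variable (I M)

/-- A connection on (the tangent bundle of) `M`, given by its horizontal lift
`φ : TM ×_M TM → T(TM)`: a smooth map with `φ(ξ, x) ∈ T_x(TM)` and `dπ_x (φ(ξ, x)) = ξ` for
`ξ, x ∈ T_p M`. The associated covariant derivative is `∇_V W = dW(V) - φ(V, W)`.
No linearity in `ξ` or `x` is required, so the linear connections are a special case. -/
structure Connection [IsManifold I ∞ M] where
  lift : ∀ {p : M} (_ξ x : TangentSpace I p), TangentSpace I.tangent (⟨p, x⟩ : TangentBundle I M)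
  contMDiff_lift : ContMDiff (I.prod 𝓘(ℝ, E × E)) I.tangent.tangent ∞
    (fun z : TotalSpace (E × E) (fun p : M => TangentSpace I p × TangentSpace I p) =>
      (⟨⟨z.proj, z.2.2⟩, lift z.2.1 z.2.2⟩ : TangentBundle I.tangent (TangentBundle I M)))
  mfderiv_proj_lift : ∀ {p : M} (ξ x : TangentSpace I p),
    mfderiv I.tangent I (fun v : TangentBundle I M => v.proj) ⟨p, x⟩ (lift ξ x) = ξ

variable {I M}

namespace Connection

variable [IsManifold I ∞ M]

/-- The connection induced on the path space, `φ̃ : T(P M) ×_{P M} T(P M) → T(T(P M))`, defined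
pointwise: `φ̃(V, W)(t) = φ(V t, W t)`. -/
def induced (φ : Connection I M) {γ : PathSpace I M} (V W : PathTangentSpace I γ) :
    PathTangentBundle I.tangent (TangentBundle I M) :=
  ⟨fun t => ⟨⟨γ t, W.vec t⟩, φ.lift (V.vec t) (W.vec t)⟩, by
    have h : ContMDiff (𝓡∂ 1) (I.prod 𝓘(ℝ, E × E)) ∞ (fun t : unitInterval =>
        (⟨γ t, (V.vec t, W.vec t)⟩ :
          TotalSpace (E × E) (fun p : M => TangentSpace I p × TangentSpace I p))) := by
      intro t
      have hV := (Bundle.contMDiffAt_totalSpace.1 (V.1.contMDiff t)).2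
      have hW := (Bundle.contMDiffAt_totalSpace.1 (W.1.contMDiff t)).2
      refine Bundle.contMDiffAt_totalSpace.2 ⟨γ.contMDiff t, ?_⟩
      rw [V.2 t] at hV
      rw [W.2 t] at hW
      refine (hV.prodMk_space hW).congr_of_eventuallyEq (Filter.Eventually.of_forall fun s => ?_)
      change _ = ((trivializationAt E (TangentSpace I) (γ t) (V.1 s)).2,
        (trivializationAt E (TangentSpace I) (γ t) (W.1 s)).2)
      rw [← V.mk_vec s, ← W.mk_vec s]
      rfl
    exact φ.contMDiff_lift.comp h⟩

end Connection

/-! ### Curves and geodesics in `M` -/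

/-- The curve `c` in `M` has velocity `v ∈ T_{c s} M` at the parameter `s`, within `J ⊆ ℝ`. -/
def HasVelocityWithinAt [IsManifold I ∞ M] (c : ℝ → M) (v : TangentBundle I M)
    (J : Set ℝ) (s : ℝ) : Prop :=
  ∃ w : TangentSpace I (c s), v = ⟨c s, w⟩ ∧
    HasMFDerivWithinAt 𝓘(ℝ) I c J s ((1 : ℝ →L[ℝ] ℝ).smulRight w)

/-- `c` is a geodesic on `J`: it has a velocity curve `c' = u` in `TM`, and the velocity of `u` in
`T(TM)` is the horizontal lift `φ(c', c')`, that is, `∇_{c'} c' = (c')' - φ(c', c') = 0`. -/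
def Connection.IsGeodesicOn [IsManifold I ∞ M] (φ : Connection I M) (c : ℝ → M)
    (J : Set ℝ) : Prop :=
  ∃ u : ℝ → TangentBundle I M, ∀ s ∈ J, HasVelocityWithinAt c (u s) J s ∧
    HasVelocityWithinAt (I := I.tangent) u ⟨u s, φ.lift (u s).2 (u s).2⟩ J s

/-- `M` is geodesically complete: for every `v ∈ TM` there is a geodesic, defined on all of `ℝ`,
with velocity `v` at `0`. -/
def Connection.GeodesicallyComplete [IsManifold I ∞ M] (φ : Connection I M) : Prop :=
  ∀ v : TangentBundle I M, ∃ c : ℝ → M,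
    φ.IsGeodesicOn c Set.univ ∧ HasVelocityWithinAt c v Set.univ 0

/-! ### Curves and geodesics in the path space -/

/-- The `C¹` norm `sup_t max (|h t|, |h' t|)` of a smooth function `h` on `[0,1]`. -/
def c1Norm (h : unitInterval → ℝ) : ℝ :=
  ⨆ t : unitInterval,
    max |h t| |derivWithin (Set.IccExtend zero_le_one h) (Set.Icc (0 : ℝ) 1) t|

/-- The curve `s ↦ Γ s` in the path space `P M` has velocity `V ∈ T_{Γ s} (P M)` at the parameter
`s`, within `J ⊆ ℝ`. The smooth structure of `P M` is the one modelled on the spaces `X_γ` with the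
`C¹` norm; it is tested here, as that of `M` may be, on the smooth functions `f : M → ℝ` (the
coordinate functions of charts or of an embedding, cut off, among them): `σ ↦ f ∘ Γ σ` has
derivative `df ∘ V` at `s` as a curve in the space of smooth functions on `[0,1]` with the `C¹`
norm. In particular `V t` is the partial derivative `∂_s Γ(s, t)`. -/
def HasPathVelocityWithinAt [IsManifold I ∞ M] (Γ : ℝ → PathSpace I M)
    (V : PathTangentBundle I M) (J : Set ℝ) (s : ℝ) : Prop :=
  (∀ t, (V t).proj = Γ s t) ∧
    ∀ f : ContMDiffMap I 𝓘(ℝ) M ℝ ∞,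
      Filter.Tendsto
        (fun σ => c1Norm fun t =>
          (f (Γ σ t) - f (Γ s t)) / (σ - s) - mvfderiv I f (V t).proj (V t).2)
        (𝓝[J \ {s}] s) (𝓝 0)

/-- The path `t ↦ π (V t)` at which the tangent vector `V` of the path space is attached. -/
def PathTangentBundle.foot [IsManifold I ∞ M] (V : PathTangentBundle I M) : PathSpace I M :=
  ⟨fun t => (V t).proj, (Bundle.contMDiff_proj (TangentSpace I)).comp V.contMDiff⟩

/-- `V ∈ T(P M)` as an element of the tangent space `X_γ` at its foot `γ`. -/
def PathTangentBundle.toTangentSpace [IsManifold I ∞ M] (V : PathTangentBundle I M) :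
    PathTangentSpace I (PathTangentBundle.foot V) :=
  ⟨V, fun _ => rfl⟩

/-- `Γ` is a geodesic of the induced connection on `J`: it has a velocity curve `Γ' = U` in
`T(P M)`, and the velocity of `U` in `T(T(P M))` is the horizontal lift `φ̃(Γ', Γ')`, that is,
`∇̃_{Γ'} Γ' = (Γ')' - φ̃(Γ', Γ') = 0`. -/
def Connection.IsPathGeodesicOn [IsManifold I ∞ M] (φ : Connection I M)
    (Γ : ℝ → PathSpace I M) (J : Set ℝ) : Prop :=
  ∃ U : ℝ → PathTangentBundle I M, ∀ s ∈ J, HasPathVelocityWithinAt Γ (U s) J s ∧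
    HasPathVelocityWithinAt (I := I.tangent) U
      (φ.induced (PathTangentBundle.toTangentSpace (U s))
        (PathTangentBundle.toTangentSpace (U s))) J s

/-- `P M` is geodesically complete: for every `V ∈ T(P M)` there is a geodesic of the induced
connection, defined on all of `ℝ`, with velocity `V` at `0`. -/
def Connection.PathGeodesicallyComplete [IsManifold I ∞ M] (φ : Connection I M) : Prop :=
  ∀ V : PathTangentBundle I M, ∃ Γ : ℝ → PathSpace I M,
    φ.IsPathGeodesicOn Γ Set.univ ∧ HasPathVelocityWithinAt Γ V Set.univ 0

/-- The curve `Γ` in `P M` is twice differentiable on `J`: it has a velocity curve in `T(P M)`,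
which has a velocity curve in `T(T(P M))`. -/
def IsTwiceDifferentiablePathOn [IsManifold I ∞ M] (Γ : ℝ → PathSpace I M) (J : Set ℝ) : Prop :=
  ∃ (U : ℝ → PathTangentBundle I M)
    (A : ℝ → PathTangentBundle I.tangent (TangentBundle I M)),
    ∀ s ∈ J, HasPathVelocityWithinAt Γ (U s) J s ∧
      HasPathVelocityWithinAt (I := I.tangent) U (A s) J s

end PathGeometry

end

noncomputable section

namespace PathGeometry

/-! ### Smoothness of postcomposition on spaces of continuous functions -/

section Postcomposition

universe u w

variable {K : Type w} [TopologicalSpace K] [CompactSpace K]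

variable {E F G : Type*} [NormedAddCommGroup E] [NormedSpace ℝ E] [NormedAddCommGroup F]
  [NormedSpace ℝ F] [NormedAddCommGroup G] [NormedSpace ℝ G]

/-- A continuous bilinear map, applied pointwise to continuous functions. -/
def pointwiseBilin (b : G →L[ℝ] E →L[ℝ] F) : C(K, G) →L[ℝ] C(K, E) →L[ℝ] C(K, F) :=
  LinearMap.mkContinuous₂
    (LinearMap.mk₂ ℝ (fun (A : C(K, G)) (h : C(K, E)) =>
        (⟨fun x => b (A x) (h x), by fun_prop⟩ : C(K, F)))
      (fun _ _ _ => by ext; simp) (fun _ _ _ => by ext; simp)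
      (fun _ _ _ => by ext; simp) (fun _ _ _ => by ext; simp)) ‖b‖
    (fun A h => by
      refine (ContinuousMap.norm_le _ (by positivity)).2 fun x => ?_
      refine (b.le_opNorm₂ _ _).trans ?_
      gcongr
      · exact A.norm_coe_le_norm x
      · exact h.norm_coe_le_norm x)

theorem hasFDerivAt_postcomp (b : G →L[ℝ] E →L[ℝ] F) (hb : ∀ g, ‖b g‖ ≤ ‖g‖) (f : C(E, F))
    (f' : C(E, G)) (hf : ∀ x, HasFDerivAt f (b (f' x)) x) (u : C(K, E)) :
    HasFDerivAt (fun v : C(K, E) => f.comp v) (pointwiseBilin b (f'.comp u)) u := by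
  rw [hasFDerivAt_iff_isLittleO_nhds_zero, Asymptotics.isLittleO_iff]
  intro ε hε
  have hcont : Continuous fun v : C(K, E) => f'.comp v := ContinuousMap.continuous_postcomp f'
  obtain ⟨δ, hδ, hball⟩ := Metric.continuousAt_iff.1 hcont.continuousAt ε hε
  filter_upwards [Metric.ball_mem_nhds (0 : C(K, E)) hδ] with h hh
  refine (ContinuousMap.norm_le _ (by positivity)).2 fun x => ?_
  have hh' : ‖h‖ < δ := by simpa using hh
  have key := (convex_segment (u x) (u x + h x)).norm_image_sub_le_of_norm_hasFDerivWithin_le'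
    (f := f) (f' := fun y => b (f' y)) (φ := b (f' (u x))) (C := ε)
    (fun y _ => (hf y).hasFDerivWithinAt) ?_ (left_mem_segment ℝ _ _) (right_mem_segment ℝ _ _)
  · simp only [add_sub_cancel_left] at key
    exact key.trans (mul_le_mul_of_nonneg_left (h.norm_coe_le_norm x) hε.le)
  · intro y hy
    rw [segment_eq_image'] at hy
    obtain ⟨θ, hθ, rfl⟩ := hy
    have h1 : dist (u + θ • h) u < δ := by
      rw [dist_eq_norm, add_sub_cancel_left, norm_smul, Real.norm_of_nonneg hθ.1]
      exact (mul_le_of_le_one_left (norm_nonneg _) hθ.2).trans_lt hh'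
    have h2 := (ContinuousMap.dist_apply_le_dist x).trans (hball h1).le
    rw [dist_eq_norm] at h2
    rw [← map_sub]
    exact (hb _).trans (by simpa using h2)

theorem contDiff_succ_postcomp (b : G →L[ℝ] E →L[ℝ] F) (hb : ∀ g, ‖b g‖ ≤ ‖g‖) (f : C(E, F))
    (f' : C(E, G)) (hf : ∀ x, HasFDerivAt f (b (f' x)) x) {n : ℕ}
    (hf' : ContDiff ℝ n (fun v : C(K, E) => f'.comp v)) :
    ContDiff ℝ (n + 1) (fun v : C(K, E) => f.comp v) := by
  have hB : ContDiff ℝ n (pointwiseBilin (K := K) b) := ContinuousLinearMap.contDiff _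
  exact contDiff_succ_iff_hasFDerivAt.2 ⟨fun u => pointwiseBilin b (f'.comp u),
    hB.comp hf', hasFDerivAt_postcomp b hb f f' hf⟩

/-- If `f` is `C^n`, then so is `u ↦ f ∘ u` on the space of continuous functions on a compact
space. -/
theorem contDiff_postcomp {E : Type u} [NormedAddCommGroup E] [NormedSpace ℝ E] (n : ℕ) :
    ∀ {F : Type u} [NormedAddCommGroup F] [NormedSpace ℝ F] (f : C(E, F)), ContDiff ℝ n f →
      ContDiff ℝ n (fun v : C(K, E) => f.comp v) := by
  induction n with
  | zero =>
    intro F _ _ f _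
    simpa using ContinuousMap.continuous_postcomp f
  | succ n ih =>
    intro F _ _ f hf
    have hf' : ContDiff ℝ n (fderiv ℝ f) := hf.fderiv_right (by simp)
    let f' : C(E, E →L[ℝ] F) := ⟨fderiv ℝ f, hf'.continuous⟩
    push_cast
    exact contDiff_succ_postcomp (ContinuousLinearMap.id ℝ (E →L[ℝ] F)) (fun _ => le_rfl) f f'
      (fun x => (hf.differentiable (by simp) x).hasFDerivAt) (ih f' hf')

end Postcomposition

/-! ### Smooth dependence of solutions of an ODE on time and initial value -/

section LocalFlow

universe u

variable {E : Type u} [NormedAddCommGroup E] [NormedSpace ℝ E]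

/-- The projection of `ℝ` onto `[-1, 1]`. -/
abbrev clampTime : ℝ → Set.Icc (-1 : ℝ) 1 := Set.projIcc (-1) 1 (by norm_num)

/-- The primitive of a continuous function on `[-1, 1]` that vanishes at `0`. -/
def primitiveCLM (E : Type*) [NormedAddCommGroup E] [NormedSpace ℝ E] :
    C(Set.Icc (-1 : ℝ) 1, E) →L[ℝ] C(Set.Icc (-1 : ℝ) 1, E) :=
  have hc (g : C(Set.Icc (-1 : ℝ) 1, E)) : Continuous fun r => g (clampTime r) :=
    g.continuous.comp continuous_projIcc
  LinearMap.mkContinuous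
    { toFun := fun g => ⟨fun t => ∫ r in (0 : ℝ)..t, g (clampTime r),
        (intervalIntegral.continuous_primitive
          (fun a b => (hc g).intervalIntegrable a b) 0).comp continuous_subtype_val⟩
      map_add' := fun g h => by
        ext t
        exact intervalIntegral.integral_add ((hc g).intervalIntegrable _ _)
          ((hc h).intervalIntegrable _ _)
      map_smul' := fun c g => by
        ext t
        exact intervalIntegral.integral_smul _ _ } 1
    (fun g => by
      rw [one_mul]
      refine (ContinuousMap.norm_le _ (by positivity)).2 fun t => ?_
      refine (intervalIntegral.norm_integral_le_of_norm_le_const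
        fun r _ => g.norm_coe_le_norm (clampTime r)).trans ?_
      rw [sub_zero]
      exact mul_le_of_le_one_right (norm_nonneg _) (abs_le.2 t.2))

/-- The solutions on `[-1, 1]` of `u' = s • f u`, `u 0 = x` depend smoothly on `(s, x)` near
`(0, q)`. -/
theorem exists_contDiffAt_solution [CompleteSpace E] {f : E → E} {n : ℕ} (hn : n ≠ 0)
    (hf : ContDiff ℝ n f) (q : E) :
    ∃ ψ : ℝ × E → C(Set.Icc (-1 : ℝ) 1, E), ContDiffAt ℝ n ψ (0, q) ∧
      ψ (0, q) = ContinuousMap.const _ q ∧ ∀ᶠ z in 𝓝 ((0 : ℝ), q),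
        ψ z (clampTime 0) = z.2 ∧ ∀ t ∈ Set.Ioo (-1 : ℝ) 1,
          HasDerivAt (fun r => ψ z (clampTime r)) (z.1 • f (ψ z (clampTime t))) t := by
  let fc : C(E, E) := ⟨f, hf.continuous⟩
  let G : (ℝ × E) × C(Set.Icc (-1 : ℝ) 1, E) → C(Set.Icc (-1 : ℝ) 1, E) := fun p =>
    p.2 - ContinuousLinearMap.const ℝ _ p.1.2 - p.1.1 • primitiveCLM E (fc.comp p.2)
  let q₀ : C(Set.Icc (-1 : ℝ) 1, E) := ContinuousMap.const _ q
  have hG : ContDiff ℝ n G := by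
    have h1 : ContDiff ℝ n fun v : C(Set.Icc (-1 : ℝ) 1, E) => fc.comp v :=
      contDiff_postcomp n fc hf
    have h2 : ContDiff ℝ n fun p : (ℝ × E) × C(Set.Icc (-1 : ℝ) 1, E) => fc.comp p.2 :=
      h1.comp contDiff_snd
    exact (contDiff_snd.sub ((ContinuousLinearMap.contDiff _).comp contDiff_fst.snd)).sub
      (contDiff_fst.fst.smul ((primitiveCLM E).contDiff.comp h2))
  have hn' : (n : WithTop ℕ∞) ≠ 0 := by exact_mod_cast hn
  have hinv : fderiv ℝ G ((0, q), q₀) ∘L .inr ℝ (ℝ × E) C(Set.Icc (-1 : ℝ) 1, E) =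
      ContinuousLinearMap.id ℝ _ := by
    have h1 : HasFDerivAt (fun u => G ((0, q), u))
        (fderiv ℝ G ((0, q), q₀) ∘L .inr ℝ (ℝ × E) C(Set.Icc (-1 : ℝ) 1, E)) q₀ :=
      ((hG.differentiable hn') ((0, q), q₀)).hasFDerivAt.comp q₀ (hasFDerivAt_prodMk_right _ _)
    refine h1.unique ?_
    have h2 : (fun u => G ((0, q), u)) = fun u => u - ContinuousLinearMap.const ℝ _ q := by
      ext u t
      simp [G]
    rw [h2]
    exact (hasFDerivAt_id q₀).sub_const _
  have hinv' : (fderiv ℝ G ((0, q), q₀) ∘L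
      .inr ℝ (ℝ × E) C(Set.Icc (-1 : ℝ) 1, E)).IsInvertible := by
    rw [hinv]
    exact ⟨ContinuousLinearEquiv.refl ℝ _, rfl⟩
  have hGat : ContDiffAt ℝ n G ((0, q), q₀) := hG.contDiffAt
  have hG0 : G ((0, q), q₀) = 0 := by
    ext t
    simp [G, q₀]
  refine ⟨hGat.implicitFunction hn' hinv', hGat.contDiffAt_implicitFunction hn' hinv',
    hGat.implicitFunction_apply_self hn' hinv', ?_⟩
  filter_upwards [hGat.eventually_apply_implicitFunction hn' hinv'] with z hz
  rw [hG0] at hz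
  set v := hGat.implicitFunction hn' hinv' z
  have hv (t : Set.Icc (-1 : ℝ) 1) :
      v t = z.2 + z.1 • ∫ r in (0 : ℝ)..t, f (v (clampTime r)) := by
    have := congrArg (fun g : C(Set.Icc (-1 : ℝ) 1, E) => g t) hz
    simp only [G, ContinuousMap.sub_apply, ContinuousMap.zero_apply, sub_sub, sub_eq_zero] at this
    exact this
  have hval {t : ℝ} (ht : t ∈ Set.Icc (-1 : ℝ) 1) : (clampTime t : ℝ) = t := by
    rw [clampTime, Set.projIcc_of_mem _ ht]
  refine ⟨?_, fun t ht => ?_⟩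
  · rw [hv, hval (by norm_num)]
    simp
  · have hcont : Continuous fun r => f (v (clampTime r)) :=
      hf.continuous.comp (v.continuous.comp continuous_projIcc)
    have h1 := ((hcont.integral_hasStrictDerivAt 0 t).hasDerivAt.const_smul z.1).const_add z.2
    refine h1.congr_of_eventuallyEq ?_
    filter_upwards [Ioo_mem_nhds ht.1 ht.2] with r hr
    rw [hv, hval ⟨hr.1.le, hr.2.le⟩]
    rfl

theorem exists_contDiff_eventuallyEq [FiniteDimensional ℝ E] {F : Type*} [NormedAddCommGroup F]
    [NormedSpace ℝ F] {g : E → F} {n : ℕ} {q : E} (hg : ContDiffAt ℝ n g q) :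
    ∃ f : E → F, ContDiff ℝ n f ∧ f =ᶠ[𝓝 q] g := by
  obtain ⟨U, hU, hgU⟩ := hg.contDiffOn (m := n) le_rfl (by simp)
  obtain ⟨r, hr, hrU⟩ := Metric.mem_nhds_iff.1 hU
  let b : ContDiffBump q := ⟨r / 4, r / 2, by positivity, by linarith⟩
  refine ⟨fun x => b x • g x, contDiff_iff_contDiffAt.2 fun x => ?_, ?_⟩
  · by_cases hx : x ∈ Metric.ball q r
    · exact b.contDiffAt.smul (hgU.contDiffAt (Filter.mem_of_superset
        (Metric.isOpen_ball.mem_nhds hx) hrU))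
    · have : (fun x => b x • g x) =ᶠ[𝓝 x] fun _ => 0 := by
        have hx' : x ∈ (Metric.closedBall q (r / 2))ᶜ := by
          simp only [Metric.mem_ball, not_lt, Set.mem_compl_iff, Metric.mem_closedBall] at hx ⊢
          linarith
        filter_upwards [Metric.isClosed_closedBall.isOpen_compl.mem_nhds hx'] with y hy
        simp only [Set.mem_compl_iff, Metric.mem_closedBall, not_le] at hy
        rw [b.zero_of_le_dist hy.le, zero_smul]
      exact contDiffAt_const.congr_of_eventuallyEq this
  · filter_upwards [b.eventuallyEq_one] with x hx
    rw [hx]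
    simp

end LocalFlow

/-! ### Smoothness of the flow of a complete vector field -/

section Flow

variable {E : Type*} [NormedAddCommGroup E] [NormedSpace ℝ E]
  {H : Type*} [TopologicalSpace H] {I : ModelWithCorners ℝ E H} [I.Boundaryless]
  {N : Type*} [TopologicalSpace N] [ChartedSpace H N] [IsManifold I ∞ N]

/-- The representation of a vector field in the preferred chart at `p`. -/
def chartVectorField (X : ∀ x : N, TangentSpace I x) (p : N) (y : E) : E :=
  mfderiv I 𝓘(ℝ, E) (extChartAt I p) ((extChartAt I p).symm y) (X ((extChartAt I p).symm y))

theorem contDiffAt_chartVectorField {X : ∀ x : N, TangentSpace I x} {n : WithTop ℕ∞} (hn : n ≤ ∞)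
    (hX : ContMDiff I I.tangent n (fun x => (⟨x, X x⟩ : TangentBundle I N))) (p : N) :
    ContDiffAt ℝ n (chartVectorField X p) (extChartAt I p p) := by
  have : IsManifold I 1 N := .of_le (n := ∞) (by simp)
  have : IsManifold I n N := .of_le (n := ∞) hn
  have h1 := (contMDiffAt_section p).1 (hX p)
  have h2 : ContMDiffAt 𝓘(ℝ, E) I n (extChartAt I p).symm (extChartAt I p p) :=
    (contMDiffOn_extChartAt_symm p).contMDiffAt (extChartAt_target_mem_nhds p)
  have h3 := ContMDiffAt.comp_of_eq h1 h2 (extChartAt_to_inv p)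
  refine h3.contDiffAt.congr_of_eventuallyEq ?_
  filter_upwards [extChartAt_target_mem_nhds (I := I) p] with y hy
  have hy' : (extChartAt I p).symm y ∈ (chartAt H p).source := by
    rw [← extChartAt_source I]
    exact (extChartAt I p).map_target hy
  have h4 := DFunLike.congr_fun
    (TangentBundle.continuousLinearMapAt_trivializationAt (I := I) hy')
    (X ((extChartAt I p).symm y))
  refine h4.symm.trans ?_
  have h5 : (extChartAt I p).symm y ∈ (trivializationAt E (TangentSpace I) p).baseSet := hy'
  exact (trivializationAt E (TangentSpace I) p).continuousLinearMapAt_apply_of_mem ℝ h5 _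

theorem hasMFDerivAt_extChartAt_symm_comp {X : ∀ x : N, TangentSpace I x} {p : N} {w : ℝ → E}
    {a t : ℝ} (hw : HasDerivAt w (a • chartVectorField X p (w t)) t)
    (ht : w t ∈ (extChartAt I p).target) :
    HasMFDerivAt 𝓘(ℝ) I (fun r => (extChartAt I p).symm (w r)) t
      ((1 : ℝ →L[ℝ] ℝ).smulRight ((a • X) ((extChartAt I p).symm (w t)))) := by
  have : IsManifold I 1 N := .of_le (n := ∞) (by simp)
  have h1 : HasMFDerivAt 𝓘(ℝ, E) I (extChartAt I p).symm (w t)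
      (mfderiv 𝓘(ℝ, E) I (extChartAt I p).symm (w t)) := by
    have := mdifferentiableWithinAt_extChartAt_symm ht
    rw [I.range_eq_univ, mdifferentiableWithinAt_univ] at this
    exact this.hasMFDerivAt
  have h2 := mfderivWithin_extChartAt_symm_comp_mfderiv_extChartAt ht
  rw [I.range_eq_univ, mfderivWithin_univ] at h2
  have h3 : HasMFDerivAt 𝓘(ℝ) 𝓘(ℝ, E) w t _ := hw.hasFDerivAt.hasMFDerivAt
  refine (h1.comp t h3).congr_mfderiv ?_
  ext
  have h4 := DFunLike.congr_fun h2 (X ((extChartAt I p).symm (w t)))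
  have h5 : ∀ c : ℝ, mfderiv 𝓘(ℝ, E) I (extChartAt I p).symm (w t)
      (c • chartVectorField X p (w t)) = c • X ((extChartAt I p).symm (w t)) := fun c => by
    refine ((mfderiv 𝓘(ℝ, E) I (extChartAt I p).symm (w t)).map_smul c _).trans ?_
    exact congrArg (c • ·) h4
  change mfderiv 𝓘(ℝ, E) I (extChartAt I p).symm (w t)
    ((1 : ℝ) • (a • chartVectorField X p (w t))) =
      (1 : ℝ) • (a • X ((extChartAt I p).symm (w t)))
  rw [one_smul, one_smul]
  exact h5 a

variable [T2Space N] {X : ∀ x : N, TangentSpace I x} {Φ : ℝ → N → N}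

theorem flow_add (hX : ContMDiff I I.tangent ∞ (fun x => (⟨x, X x⟩ : TangentBundle I N)))
    (hΦ : ∀ p, IsMIntegralCurve (fun s => Φ s p) X) (h0 : ∀ p, Φ 0 p = p) (s t : ℝ) (p : N) :
    Φ (s + t) p = Φ s (Φ t p) := by
  have hn1 : IsManifold I 1 N := .of_le (n := ∞) (by simp)
  refine congrFun (isMIntegralCurve_Ioo_eq_of_contMDiff_boundaryless (t₀ := 0)
    (hX.of_le (by simp)) ((hΦ p).comp_add t) (hΦ (Φ t p)) ?_) s
  simp [h0]

variable [FiniteDimensional ℝ E]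

theorem eventually_flow_eq
    (hX : ContMDiff I I.tangent ∞ (fun x => (⟨x, X x⟩ : TangentBundle I N)))
    (hΦ : ∀ p, IsMIntegralCurve (fun s => Φ s p) X) (h0 : ∀ p, Φ 0 p = p) {n : ℕ} (hn : n ≠ 0)
    (p : N) :
    ∃ g : ℝ × E → E, ContDiffAt ℝ n g (0, extChartAt I p p) ∧
      g (0, extChartAt I p p) = extChartAt I p p ∧ ∀ᶠ z in 𝓝 ((0 : ℝ), p),
        Φ z.1 z.2 = (extChartAt I p).symm (g (2 * z.1, extChartAt I p z.2)) := by
  have hn1 : IsManifold I 1 N := .of_le (n := ∞) (by simp)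
  obtain ⟨f, hf, hfe⟩ := exists_contDiff_eventuallyEq
    ((contDiffAt_chartVectorField le_rfl hX p).of_le (m := n) (by exact_mod_cast le_top))
  obtain ⟨ψ, hψ, hψ0, hψe⟩ := exists_contDiffAt_solution hn hf (extChartAt I p p)
  obtain ⟨r, hr, hrW⟩ := Metric.mem_nhds_iff.1
    (Filter.inter_mem hfe (extChartAt_target_mem_nhds (I := I) p))
  have hψb : ∀ᶠ z in 𝓝 ((0 : ℝ), extChartAt I p p), ∀ t,
      f (ψ z t) = chartVectorField X p (ψ z t) ∧ ψ z t ∈ (extChartAt I p).target := by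
    filter_upwards [hψ.continuousAt.eventually (Metric.ball_mem_nhds _ hr)] with z hz t
    refine hrW ?_
    have := (ContinuousMap.dist_apply_le_dist t).trans_lt hz
    rwa [hψ0] at this
  have hlim : Filter.Tendsto (fun z : ℝ × N => (2 * z.1, extChartAt I p z.2)) (𝓝 (0, p))
      (𝓝 (0, extChartAt I p p)) := by
    have h1 : ContinuousAt (fun z : ℝ × N => (2 * z.1, extChartAt I p z.2)) (0, p) :=
      (continuousAt_const.mul continuousAt_fst).prodMk
        (ContinuousAt.comp (f := Prod.snd) (x := ((0 : ℝ), p)) (continuousAt_extChartAt p)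
          continuousAt_snd)
    simpa [ContinuousAt] using h1
  let ev : C(Set.Icc (-1 : ℝ) 1, E) →L[ℝ] E := ContinuousMap.evalCLM ℝ (clampTime (1 / 2))
  have hev : ContDiff ℝ n fun u : C(Set.Icc (-1 : ℝ) 1, E) => u (clampTime (1 / 2)) := ev.contDiff
  refine ⟨fun z => ψ z (clampTime (1 / 2)), hev.contDiffAt.comp _ hψ,
    DFunLike.congr_fun hψ0 _, ?_⟩
  filter_upwards [hlim.eventually hψe, hlim.eventually hψb,
    continuousAt_snd.eventually (extChartAt_source_mem_nhds (I := I) p)] with z hz hzb hzs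
  obtain ⟨hz0, hzd⟩ := hz
  set a := 2 * z.1 with ha
  set v := ψ (a, extChartAt I p z.2)
  have hv : IsMIntegralCurveOn (fun t => (extChartAt I p).symm (v (clampTime t))) (a • X)
      (Set.Ioo (-1) 1) := fun t ht => by
    refine (hasMFDerivAt_extChartAt_symm_comp ?_ (hzb (clampTime t)).2).hasMFDerivWithinAt
    rw [← (hzb (clampTime t)).1]
    exact hzd t ht
  have hX1 : ContMDiff I I.tangent 1 (fun x => (⟨x, (a • X) x⟩ : TangentBundle I N)) :=
    (hX.of_le (by simp)).const_smul_section
  have key := isMIntegralCurveOn_Ioo_eqOn_of_contMDiff_boundaryless (t₀ := 0)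
    (by norm_num : (0 : ℝ) ∈ Set.Ioo (-1 : ℝ) 1) hX1 (((hΦ z.2).comp_mul a).isMIntegralCurveOn _) hv
    (by simp only [Function.comp_apply, zero_mul, h0, hz0]
        exact ((extChartAt I p).left_inv hzs).symm)
  have h2 := key (by norm_num : (1 / 2 : ℝ) ∈ Set.Ioo (-1 : ℝ) 1)
  refine Eq.trans ?_ h2
  rw [Function.comp_apply, ha, one_div, inv_mul_cancel_left₀ two_ne_zero]

theorem contMDiffAt_flow_zero
    (hX : ContMDiff I I.tangent ∞ (fun x => (⟨x, X x⟩ : TangentBundle I N)))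
    (hΦ : ∀ p, IsMIntegralCurve (fun s => Φ s p) X) (h0 : ∀ p, Φ 0 p = p) (n : ℕ) (p : N) :
    ContMDiffAt (𝓘(ℝ).prod I) I n (fun z : ℝ × N => Φ z.1 z.2) (0, p) := by
  have : IsManifold I (n + 1 : ℕ) N := .of_le (n := ∞) (by exact_mod_cast le_top)
  obtain ⟨g, hg, hg0, hgΦ⟩ := eventually_flow_eq hX hΦ h0 n.succ_ne_zero p
  refine ContMDiffAt.of_le (n := (n + 1 : ℕ)) ?_ (by exact_mod_cast n.le_succ)
  refine ContMDiffAt.congr_of_eventuallyEq ?_ hgΦ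
  have h1 : ContMDiffAt (𝓘(ℝ).prod I) 𝓘(ℝ, ℝ × E) (n + 1 : ℕ)
      (fun z : ℝ × N => (2 * z.1, extChartAt I p z.2)) (0, p) := by
    refine ContMDiffAt.prodMk_space ?_ ?_
    · exact (contDiff_const.mul contDiff_id).contMDiff.contMDiffAt.comp (0, p) contMDiffAt_fst
    · exact ContMDiffAt.comp (0, p) (g := extChartAt I p) contMDiffAt_extChartAt contMDiffAt_snd
  have h2 : ContMDiffAt (𝓘(ℝ).prod I) 𝓘(ℝ, E) (n + 1 : ℕ)
      (fun z : ℝ × N => g (2 * z.1, extChartAt I p z.2)) (0, p) :=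
    ContMDiffAt.comp_of_eq (g := g) hg.contMDiffAt h1 (by simp)
  refine ContMDiffAt.comp_of_eq (g := (extChartAt I p).symm)
    ((contMDiffOn_extChartAt_symm p).contMDiffAt (extChartAt_target_mem_nhds p)) h2 ?_
  simpa using hg0

theorem contMDiff_flow_apply
    (hX : ContMDiff I I.tangent ∞ (fun x => (⟨x, X x⟩ : TangentBundle I N)))
    (hΦ : ∀ p, IsMIntegralCurve (fun s => Φ s p) X) (h0 : ∀ p, Φ 0 p = p) (n : ℕ) (s : ℝ) :
    ContMDiff I I n (Φ s) := by
  intro p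
  have : IsManifold I n N := .of_le (n := ∞) (by exact_mod_cast le_top)
  have hcont : Continuous fun s => Φ s p := (hΦ p).continuous
  have hloc (s : ℝ) : ∃ V ∈ 𝓝 s, ∀ t ∈ V, ∀ t' ∈ V,
      ContMDiffAt I I n (Φ t) p → ContMDiffAt I I n (Φ t') p := by
    have hev := (contMDiffAt_iff_contMDiffAt_nhds (by simp)).1
      (contMDiffAt_flow_zero hX hΦ h0 n (Φ s p))
    rw [nhds_prod_eq, Filter.eventually_prod_iff] at hev
    obtain ⟨P, hP, Q, hQ, hPQ⟩ := hev
    obtain ⟨ε, hε, hεP⟩ := Metric.eventually_nhds_iff.1 hP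
    refine ⟨Metric.ball s (ε / 2) ∩ {t | Q (Φ t p)},
      Filter.inter_mem (Metric.ball_mem_nhds _ (by positivity)) (hcont.continuousAt.eventually hQ),
      fun t ht t' ht' h => ?_⟩
    have hdist : dist (t' - t) 0 < ε := by
      rw [dist_zero_right, ← dist_eq_norm]
      linarith [dist_triangle_right t' t s, Metric.mem_ball.1 ht.1, Metric.mem_ball.1 ht'.1]
    have h1 := hPQ (hεP hdist) ht.2
    have h2 : Φ t' = fun x => Φ (t' - t) (Φ t x) := by
      ext x
      rw [← flow_add hX hΦ h0, sub_add_cancel]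
    rw [h2]
    exact ContMDiffAt.comp p (g := fun z : ℝ × N => Φ z.1 z.2) (f := fun x => (t' - t, Φ t x)) h1
      (contMDiffAt_const.prodMk h)
  have hclopen : IsClopen {t | ContMDiffAt I I n (Φ t) p} := by
    refine ⟨⟨isOpen_iff_mem_nhds.2 fun s hs => ?_⟩, isOpen_iff_mem_nhds.2 fun s hs => ?_⟩
    · obtain ⟨V, hV, h⟩ := hloc s
      filter_upwards [hV] with t ht h'
      exact hs (h t ht s (mem_of_mem_nhds hV) h')
    · obtain ⟨V, hV, h⟩ := hloc s
      filter_upwards [hV] with t ht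
      exact h s (mem_of_mem_nhds hV) t ht hs
  have huniv := hclopen.eq_univ ⟨0, by
    have : Φ 0 = id := funext h0
    rw [Set.mem_ofPred, this]
    exact contMDiffAt_id⟩
  exact huniv.ge (Set.mem_univ s)

/-- The flow of a complete smooth vector field is smooth. -/
theorem contMDiff_flow
    (hX : ContMDiff I I.tangent ∞ (fun x => (⟨x, X x⟩ : TangentBundle I N)))
    (hΦ : ∀ p, IsMIntegralCurve (fun s => Φ s p) X) (h0 : ∀ p, Φ 0 p = p) :
    ContMDiff (𝓘(ℝ).prod I) I ∞ (fun z : ℝ × N => Φ z.1 z.2) := by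
  refine contMDiff_infty.2 fun n => ?_
  rintro ⟨s, p⟩
  have h1 : (fun z : ℝ × N => Φ z.1 z.2) = fun z => Φ (z.1 - s) (Φ s z.2) := by
    ext z
    rw [← flow_add hX hΦ h0, sub_add_cancel]
  rw [h1]
  have h2 : ContMDiffAt (𝓘(ℝ).prod I) (𝓘(ℝ).prod I) n
      (fun z : ℝ × N => (z.1 - s, Φ s z.2)) (s, p) :=
    ContMDiffAt.prodMk
      ((contDiff_id.sub contDiff_const).contMDiff.contMDiffAt.comp (s, p) contMDiffAt_fst)
      ((contMDiff_flow_apply hX hΦ h0 n s p).comp (s, p) contMDiffAt_snd)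
  exact ContMDiffAt.comp_of_eq (contMDiffAt_flow_zero hX hΦ h0 n (Φ s p)) h2 (by simp)

end Flow

/-! ### Velocities of curves -/

theorem t2Space_totalSpace {B F : Type*} [TopologicalSpace B] [T2Space B] [TopologicalSpace F]
    [T2Space F] (V : B → Type*) [TopologicalSpace (TotalSpace F V)]
    [∀ b, TopologicalSpace (V b)] [FiberBundle F V] : T2Space (TotalSpace F V) := by
  refine ⟨fun x y hxy => ?_⟩
  by_cases h : x.proj = y.proj
  · have hx : x ∈ (trivializationAt F V x.proj).source := by simp
    have hy : y ∈ (trivializationAt F V x.proj).source := by simp [h]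
    set e := trivializationAt F V x.proj
    obtain ⟨U, W, hU, hW, hxU, hyW, hUW⟩ :=
      t2_separation fun h' => hxy (e.toOpenPartialHomeomorph.injOn hx hy h')
    exact ⟨_, _, e.toOpenPartialHomeomorph.isOpen_inter_preimage hU,
      e.toOpenPartialHomeomorph.isOpen_inter_preimage hW, ⟨hx, hxU⟩, ⟨hy, hyW⟩,
      (hUW.preimage _).mono Set.inter_subset_right Set.inter_subset_right⟩
  · exact separated_by_continuous (FiberBundle.continuous_proj F V) h

theorem interior_nonempty_of_ordConnected {J : Set ℝ} (hJ : J.OrdConnected)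
    (hJ' : J.Nontrivial) : (interior J).Nonempty := by
  obtain ⟨a, ha, b, hb, hab⟩ := hJ'.exists_lt
  exact (Set.nonempty_Ioo.2 hab).mono
    (interior_maximal (Set.Ioo_subset_Icc_self.trans (hJ.out ha hb)) isOpen_Ioo)

theorem uniqueDiffOn_of_ordConnected {J : Set ℝ} (hJ : J.OrdConnected) (hJ' : J.Nontrivial) :
    UniqueDiffOn ℝ J :=
  uniqueDiffOn_convex hJ.convex (interior_nonempty_of_ordConnected hJ hJ')

section Velocity

variable {E : Type*} [NormedAddCommGroup E] [NormedSpace ℝ E]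
  {H : Type*} [TopologicalSpace H] {I : ModelWithCorners ℝ E H}
  {N : Type*} [TopologicalSpace N] [ChartedSpace H N] [IsManifold I ∞ N]

theorem HasVelocityWithinAt.proj_eq {c : ℝ → N} {v : TangentBundle I N} {J : Set ℝ} {s : ℝ}
    (h : HasVelocityWithinAt c v J s) : v.proj = c s := by
  obtain ⟨w, rfl, -⟩ := h
  rfl

theorem HasVelocityWithinAt.mono {c : ℝ → N} {v : TangentBundle I N} {J J' : Set ℝ} {s : ℝ}
    (h : HasVelocityWithinAt c v J s) (hJ : J' ⊆ J) : HasVelocityWithinAt c v J' s := by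
  obtain ⟨w, rfl, hw⟩ := h
  exact ⟨w, rfl, hw.mono hJ⟩

theorem HasVelocityWithinAt.congr {c c' : ℝ → N} {v : TangentBundle I N} {J : Set ℝ} {s : ℝ}
    (h : HasVelocityWithinAt c v J s) (hc : Set.EqOn c' c J) (hs : s ∈ J) :
    HasVelocityWithinAt c' v J s := by
  obtain ⟨w, rfl, hw⟩ := h
  have h0 : c' s = c s := hc hs
  have h1 := hw.congr_of_eventuallyEq (f₁ := c') (hc.eventuallyEq_of_mem self_mem_nhdsWithin) h0
  have key : ∀ (p : N) (w : TangentSpace I p), p = c' s →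
      (HasMFDerivWithinAt 𝓘(ℝ) I c' J s ((1 : ℝ →L[ℝ] ℝ).smulRight (w : E) : ℝ →L[ℝ] E)) →
      HasVelocityWithinAt c' (⟨p, w⟩ : TangentBundle I N) J s := by
    rintro p w rfl hw
    exact ⟨w, rfl, hw⟩
  exact key _ w h0.symm h1

theorem HasVelocityWithinAt.unique {c : ℝ → N} {v v' : TangentBundle I N} {J : Set ℝ} {s : ℝ}
    (hJ : UniqueDiffWithinAt ℝ J s) (h : HasVelocityWithinAt c v J s)
    (h' : HasVelocityWithinAt c v' J s) : v = v' := by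
  obtain ⟨w, rfl, hw⟩ := h
  obtain ⟨w', rfl, hw'⟩ := h'
  have h1 := hJ.uniqueMDiffWithinAt.eq hw hw'
  have h2 := DFunLike.congr_fun h1 (1 : ℝ)
  have h3 : (1 : ℝ) • w = (1 : ℝ) • w' := h2
  rw [one_smul, one_smul] at h3
  rw [h3]

theorem HasVelocityWithinAt.hasDerivWithinAt_comp {c : ℝ → N} {v : TangentBundle I N}
    {J : Set ℝ} {s : ℝ} (h : HasVelocityWithinAt c v J s) {f : N → ℝ}
    (hf : MDifferentiableAt I 𝓘(ℝ) f (c s)) :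
    HasDerivWithinAt (fun σ => f (c σ)) (mvfderiv I f v.proj v.2) J s := by
  obtain ⟨w, rfl, hw⟩ := h
  have key : ∀ L : ℝ →L[ℝ] ℝ, HasMFDerivWithinAt 𝓘(ℝ) 𝓘(ℝ) (fun σ => f (c σ)) J s L →
      HasDerivWithinAt (fun σ => f (c σ)) (L 1) J s :=
    fun L hL => by
      have hL' : HasFDerivWithinAt (fun σ => f (c σ)) L J s := hL.hasFDerivWithinAt
      exact hL'.hasDerivWithinAt
  refine (key _ (hf.hasMFDerivAt.comp_hasMFDerivWithinAt s hw)).congr_deriv ?_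
  change mfderiv I 𝓘(ℝ) f (c s) ((1 : ℝ) • w) = mfderiv I 𝓘(ℝ) f (c s) w
  rw [one_smul]

theorem continuousWithinAt_of_forall_contMDiffMap [FiniteDimensional ℝ E] [T2Space N] {c : ℝ → N}
    {J : Set ℝ} {s : ℝ}
    (h : ∀ f : ContMDiffMap I 𝓘(ℝ) N ℝ ∞, ContinuousWithinAt (fun σ => f (c σ)) J s) :
    ContinuousWithinAt c J s := by
  refine (SmoothBumpFunction.nhds_basis_support (I := I) Filter.univ_mem).tendsto_right_iff.2
    fun b _ => ?_
  have h1 : ContinuousWithinAt (fun σ => b (c σ)) J s := h ⟨b, b.contMDiff⟩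
  have h2 : b (c s) ≠ 0 := by simp
  filter_upwards [h1.eventually (isOpen_ne.mem_nhds h2)] with σ hσ
  exact hσ

theorem hasDerivWithinAt_of_forall_clm [FiniteDimensional ℝ E] {g : ℝ → E} {g' : E} {J : Set ℝ}
    {s : ℝ} (h : ∀ ℓ : E →L[ℝ] ℝ, HasDerivWithinAt (fun σ => ℓ (g σ)) (ℓ g') J s) :
    HasDerivWithinAt g g' J s := by
  let L := (Module.finBasis ℝ E).equivFunL
  have h1 : HasDerivWithinAt (fun σ => L (g σ)) (L g') J s :=
    hasDerivWithinAt_pi.2 fun i =>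
      h ((ContinuousLinearMap.proj i).comp (L : E →L[ℝ] Fin (Module.finrank ℝ E) → ℝ))
  have h2 := (L.symm : (Fin (Module.finrank ℝ E) → ℝ) →L[ℝ] E).hasFDerivAt.comp_hasDerivWithinAt s h1
  simpa [Function.comp_def] using h2

/-- The velocity of a curve is determined by the derivatives of the smooth functions along it. -/
theorem hasVelocityWithinAt_of_forall_contMDiffMap [FiniteDimensional ℝ E] [I.Boundaryless]
    [T2Space N] {c : ℝ → N} {v : TangentBundle I N} {J : Set ℝ} {s : ℝ} (hv : v.proj = c s)
    (h : ∀ f : ContMDiffMap I 𝓘(ℝ) N ℝ ∞,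
      HasDerivWithinAt (fun σ => f (c σ)) (mvfderiv I f v.proj v.2) J s) :
    HasVelocityWithinAt c v J s := by
  have : IsManifold I 1 N := .of_le (n := ∞) (by simp)
  obtain ⟨p, w⟩ := v
  obtain rfl : p = c s := hv
  have hc := continuousWithinAt_of_forall_contMDiffMap fun f => (h f).continuousWithinAt
  refine ⟨w, rfl, hc, ?_⟩
  obtain ⟨b⟩ : Nonempty (SmoothBumpFunction I (c s)) := inferInstance
  let F : N → E := fun x => b x • extChartAt I (c s) x
  have hF : ContMDiff I 𝓘(ℝ, E) ∞ F := b.contMDiff_smul contMDiffOn_extChartAt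
  have hFe : F =ᶠ[𝓝 (c s)] extChartAt I (c s) := by
    filter_upwards [b.eventuallyEq_one] with x hx
    simp [F, hx]
  have hF' : HasMFDerivAt I 𝓘(ℝ, E) F (c s) (ContinuousLinearMap.id ℝ E : E →L[ℝ] E) := by
    have h1 := (mdifferentiableAt_extChartAt (I := I) (mem_chart_source H (c s))).hasMFDerivAt
    rw [mfderiv_extChartAt_self] at h1
    exact h1.congr_of_eventuallyEq hFe
  have key : HasDerivWithinAt (fun σ => F (c σ)) (w : E) J s := by
    refine hasDerivWithinAt_of_forall_clm fun ℓ => ?_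
    refine (h ⟨fun x => ℓ (F x), ℓ.contMDiff.comp hF⟩).congr_deriv ?_
    have h2 : HasMFDerivAt I 𝓘(ℝ) (fun x => ℓ (F x)) (c s) (ℓ.comp (ContinuousLinearMap.id ℝ E)) :=
      ℓ.hasMFDerivAt.comp (c s) hF'
    exact DFunLike.congr_fun h2.mfderiv w
  have key' : HasDerivWithinAt (fun σ => extChartAt I (c s) (c σ)) (w : E) J s :=
    key.congr_of_eventuallyEq ((hc.eventually hFe).mono fun _ h => h.symm) hFe.self_of_nhds.symm
  simpa [writtenInExtChartAt, Function.comp_def] using! key'.hasFDerivWithinAt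

/-- Integral curves of a smooth vector field on an interval that agree at an interior point agree
on the whole interval. -/
theorem eqOn_of_isMIntegralCurveOn [I.Boundaryless] [T2Space N] {X : ∀ x : N, TangentSpace I x}
    (hX : ContMDiff I I.tangent ∞ (fun x => (⟨x, X x⟩ : TangentBundle I N))) {J : Set ℝ}
    (hJ : J.OrdConnected) {γ γ' : ℝ → N} (hγ : IsMIntegralCurveOn γ X J)
    (hγ' : IsMIntegralCurveOn γ' X J) {s : ℝ} (hs : s ∈ interior J) (h : γ s = γ' s) :
    Set.EqOn γ γ' J := by
  have : IsManifold I 1 N := .of_le (n := ∞) (by simp)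
  have hint : Set.EqOn γ γ' (interior J) := fun t ht => by
    obtain ⟨δ, hδ, hδs⟩ := Metric.isOpen_iff.1 isOpen_interior s hs
    obtain ⟨ε, hε, hεt⟩ := Metric.isOpen_iff.1 isOpen_interior t ht
    rw [Real.ball_eq_Ioo] at hδs hεt
    have hsub : Set.Ioo (min s t - min (δ / 2) (ε / 2)) (max s t + min (δ / 2) (ε / 2)) ⊆ J := by
      have h1 : min s t - min (δ / 2) (ε / 2) ∈ J ∧ max s t + min (δ / 2) (ε / 2) ∈ J := by
        have h2 := min_le_left (δ / 2) (ε / 2)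
        have h3 := min_le_right (δ / 2) (ε / 2)
        have h4 : 0 < min (δ / 2) (ε / 2) := lt_min (by positivity) (by positivity)
        rcases le_total s t with hst | hst <;> simp only [min_eq_left, max_eq_right, min_eq_right,
          max_eq_left, hst]
        · exact ⟨interior_subset (hδs ⟨by linarith, by linarith⟩),
            interior_subset (hεt ⟨by linarith, by linarith⟩)⟩
        · exact ⟨interior_subset (hεt ⟨by linarith, by linarith⟩),
            interior_subset (hδs ⟨by linarith, by linarith⟩)⟩
      exact Set.Ioo_subset_Icc_self.trans (hJ.out h1.1 h1.2)
    have h4 : 0 < min (δ / 2) (ε / 2) := lt_min (by positivity) (by positivity)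
    exact isMIntegralCurveOn_Ioo_eqOn_of_contMDiff_boundaryless (t₀ := s)
      ⟨by linarith [min_le_left s t], by linarith [le_max_left s t]⟩ (hX.of_le (by simp))
      (hγ.mono hsub) (hγ'.mono hsub) h
      ⟨by linarith [min_le_right s t], by linarith [le_max_right s t]⟩
  refine hint.of_subset_closure hγ.continuousOn hγ'.continuousOn interior_subset ?_
  rw [(hJ.convex : Convex ℝ J).closure_interior_eq_closure_of_nonempty_interior ⟨s, hs⟩]
  exact subset_closure

end Velocity

/-! ### The `C¹` norm -/

section C1Norm

theorem contDiffOn_IccExtend {F : Type*} [NormedAddCommGroup F] [NormedSpace ℝ F]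
    {h : unitInterval → F} {n : WithTop ℕ∞} (hh : ContMDiff (𝓡∂ 1) 𝓘(ℝ, F) n h) :
    ContDiffOn ℝ n (Set.IccExtend zero_le_one h) (Set.Icc (0 : ℝ) 1) :=
  (contMDiffOn_comp_projIcc_iff.2 hh).contDiffOn

theorem bddAbove_c1Norm {h : unitInterval → ℝ} (hh : ContMDiff (𝓡∂ 1) 𝓘(ℝ) ∞ h) :
    BddAbove (Set.range fun t : unitInterval =>
      max |h t| |derivWithin (Set.IccExtend zero_le_one h) (Set.Icc (0 : ℝ) 1) t|) := by
  have h1 : ContinuousOn (derivWithin (Set.IccExtend zero_le_one h) (Set.Icc (0 : ℝ) 1))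
      (Set.Icc (0 : ℝ) 1) :=
    (contDiffOn_IccExtend hh).continuousOn_derivWithin (uniqueDiffOn_Icc zero_lt_one) (by simp)
  have h2 : Continuous fun t : unitInterval =>
      derivWithin (Set.IccExtend zero_le_one h) (Set.Icc (0 : ℝ) 1) t :=
    h1.comp_continuous continuous_subtype_val fun t => t.2
  exact (isCompact_range (hh.continuous.abs.max h2.abs)).bddAbove

theorem abs_le_c1Norm {h : unitInterval → ℝ} (hh : ContMDiff (𝓡∂ 1) 𝓘(ℝ) ∞ h)
    (t : unitInterval) : |h t| ≤ c1Norm h :=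
  (le_max_left _ _).trans (le_ciSup (bddAbove_c1Norm hh) t)

theorem c1Norm_nonneg (h : unitInterval → ℝ) : 0 ≤ c1Norm h :=
  Real.iSup_nonneg fun _ => (abs_nonneg _).trans (le_max_left _ _)

end C1Norm

/-! ### Difference quotients of smooth functions on a strip -/

section Strip

/-- The strip `ℝ × [0, 1]`. -/
abbrev strip : Set (ℝ × ℝ) := Set.univ ×ˢ Set.Icc (0 : ℝ) 1

theorem uniqueDiffOn_strip : UniqueDiffOn ℝ strip :=
  uniqueDiffOn_univ.prod (uniqueDiffOn_Icc zero_lt_one)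

theorem hasDerivAt_strip_fst {G : ℝ × ℝ → ℝ} {L : ℝ × ℝ →L[ℝ] ℝ} {σ t : ℝ}
    (hG : HasFDerivWithinAt G L strip (σ, t)) (ht : t ∈ Set.Icc (0 : ℝ) 1) :
    HasDerivAt (fun r => G (r, t)) (L (1, 0)) σ := by
  rw [← hasDerivWithinAt_univ]
  exact HasFDerivWithinAt.comp_hasDerivWithinAt (t := strip) (f := fun r => (r, t)) σ hG
    ((hasDerivWithinAt_id σ _).prodMk (hasDerivWithinAt_const σ _ t))
    fun r _ => ⟨Set.mem_univ _, ht⟩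

theorem hasDerivWithinAt_strip_snd {G : ℝ × ℝ → ℝ} {L : ℝ × ℝ →L[ℝ] ℝ}
    {σ t : ℝ} (hG : HasFDerivWithinAt G L strip (σ, t)) :
    HasDerivWithinAt (fun r => G (σ, r)) (L (0, 1)) (Set.Icc 0 1) t :=
  HasFDerivWithinAt.comp_hasDerivWithinAt (t := strip) (f := fun r => (σ, r)) t hG
    ((hasDerivWithinAt_const t _ σ).prodMk (hasDerivWithinAt_id t _))
    fun _ hr => ⟨Set.mem_univ _, hr⟩

/-- Difference quotients in the first variable converge uniformly in the second variable. -/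
theorem eventually_abs_diffQuot_sub_le {G G' : ℝ × ℝ → ℝ}
    (hG : ∀ σ, ∀ t ∈ Set.Icc (0 : ℝ) 1, HasDerivAt (fun r => G (r, t)) (G' (σ, t)) σ)
    (hG' : ContinuousOn G' strip) (s : ℝ) {ε : ℝ} (hε : 0 < ε) :
    ∀ᶠ σ in 𝓝[≠] s, ∀ t ∈ Set.Icc (0 : ℝ) 1,
      |(G (σ, t) - G (s, t)) / (σ - s) - G' (s, t)| ≤ ε := by
  let F : C(ℝ × unitInterval, ℝ) := ⟨fun z => G' (z.1, z.2),
    hG'.comp_continuous (by fun_prop) fun z => ⟨Set.mem_univ _, z.2.2⟩⟩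
  obtain ⟨δ, hδ, hδε⟩ := Metric.continuousAt_iff.1 (F.curry.continuous.continuousAt (x := s)) ε hε
  filter_upwards [nhdsWithin_le_nhds (Metric.ball_mem_nhds s hδ), self_mem_nhdsWithin]
    with σ hσ hσs t ht
  have hne : σ - s ≠ 0 := sub_ne_zero.2 hσs
  have key := (convex_ball s δ).norm_image_sub_le_of_norm_hasDerivWithin_le
    (f := fun r => G (r, t) - r * G' (s, t)) (f' := fun r => G' (r, t) - 1 * G' (s, t)) (C := ε)
    (fun r _ => ((hG r t ht).sub ((hasDerivAt_id r).mul_const _)).hasDerivWithinAt)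
    (fun r hr => ?_) (Metric.mem_ball_self hδ) hσ
  · have h1 : (G (σ, t) - G (s, t)) / (σ - s) - G' (s, t) =
        (G (σ, t) - σ * G' (s, t) - (G (s, t) - s * G' (s, t))) / (σ - s) := by
      field_simp
      ring
    rw [h1, abs_div, div_le_iff₀ (abs_pos.2 hne)]
    exact key
  · have h2 := (ContinuousMap.dist_apply_le_dist (⟨t, ht⟩ : unitInterval)).trans (hδε hr).le
    rw [one_mul]
    exact h2

/-- Difference quotients of a smooth function on the strip converge in the `C¹` norm. -/
theorem tendsto_c1Norm_diffQuot {g : ℝ × ℝ → ℝ} (hg : ContDiffOn ℝ ∞ g strip) (s : ℝ) :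
    Filter.Tendsto (fun σ => c1Norm fun t : unitInterval =>
      (g (σ, t) - g (s, t)) / (σ - s) - fderivWithin ℝ g strip (s, t) (1, 0)) (𝓝[≠] s) (𝓝 0) := by
  set D := fderivWithin ℝ g strip
  set D2 := fderivWithin ℝ D strip
  have hD : ContDiffOn ℝ ∞ D strip := hg.fderivWithin uniqueDiffOn_strip (by simp)
  have hD2 : ContinuousOn D2 strip := hD.continuousOn_fderivWithin uniqueDiffOn_strip (by simp)
  have hgD {z : ℝ × ℝ} (hz : z ∈ strip) : HasFDerivWithinAt g (D z) strip z :=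
    (hg.differentiableOn (by simp) z hz).hasFDerivWithinAt
  have hDD {z : ℝ × ℝ} (hz : z ∈ strip) (v : ℝ × ℝ) :
      HasFDerivWithinAt (fun y => D y v) ((D2 z).flip v) strip z :=
    (hD.differentiableOn (by simp) z hz).hasFDerivWithinAt.clm_apply
      (hasFDerivWithinAt_const v z strip) |>.congr_fderiv (by ext <;> simp [D2])
  have hsymm {z : ℝ × ℝ} (hz : z ∈ strip) (v w : ℝ × ℝ) : D2 z v w = D2 z w v := by
    refine ((hg z hz).isSymmSndFDerivWithinAt ?_ uniqueDiffOn_strip ?_ hz).eq v w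
    · rw [minSmoothness_of_isRCLikeNormedField]
      exact ENat.LEInfty.out
    have hc : Convex ℝ strip := convex_univ.prod (convex_Icc 0 1)
    have hne : (interior strip).Nonempty := by
      rw [interior_prod_eq, interior_univ, interior_Icc]
      exact ⟨(0, 1 / 2), Set.mem_univ _, by norm_num⟩
    rw [hc.closure_interior_eq_closure_of_nonempty_interior hne]
    exact subset_closure hz
  have h1 (ε : ℝ) (hε : 0 < ε) := eventually_abs_diffQuot_sub_le (G := g)
    (G' := fun z => D z (1, 0))
    (fun σ t ht => hasDerivAt_strip_fst (hgD ⟨Set.mem_univ _, ht⟩) ht)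
    (hD.continuousOn.clm_apply continuousOn_const) s hε
  have h2 (ε : ℝ) (hε : 0 < ε) := eventually_abs_diffQuot_sub_le (G := fun z => D z (0, 1))
    (G' := fun z => D2 z (1, 0) (0, 1))
    (fun σ t ht => hasDerivAt_strip_fst (hDD ⟨Set.mem_univ _, ht⟩ (0, 1)) ht)
    ((hD2.clm_apply continuousOn_const).clm_apply continuousOn_const) s hε
  rw [Metric.tendsto_nhds]
  intro ε hε
  filter_upwards [h1 (ε / 2) (by positivity), h2 (ε / 2) (by positivity)] with σ hσ1 hσ2
  rw [dist_zero_right, Real.norm_of_nonneg (c1Norm_nonneg _)]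
  refine lt_of_le_of_lt (ciSup_le fun t => max_le (hσ1 t t.2) ?_) (half_lt_self hε)
  have hmem (r : ℝ) : (r, (t : ℝ)) ∈ strip := ⟨Set.mem_univ _, t.2⟩
  have h3 : HasDerivWithinAt
      (fun τ : ℝ => (g (σ, τ) - g (s, τ)) / (σ - s) - D (s, τ) (1, 0))
      ((D (σ, t) (0, 1) - D (s, t) (0, 1)) / (σ - s) - D2 (s, t) (0, 1) (1, 0))
      (Set.Icc 0 1) t :=
    ((hasDerivWithinAt_strip_snd (hgD (hmem σ))).sub
      (hasDerivWithinAt_strip_snd (hgD (hmem s)))).div_const _ |>.sub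
      (hasDerivWithinAt_strip_snd (hDD (hmem s) (1, 0)))
  have h4 := h3.congr_of_mem (f₁ := Set.IccExtend zero_le_one fun t : unitInterval =>
      (g (σ, t) - g (s, t)) / (σ - s) - D (s, t) (1, 0)) (fun τ hτ => by
    rw [Set.IccExtend_of_mem _ _ hτ]) t.2
  rw [h4.derivWithin (uniqueDiffOn_Icc zero_lt_one _ t.2), hsymm (hmem s)]
  exact hσ2 t t.2

end Strip

/-! ### Velocities of curves in the path space -/

section PathVelocity

variable {E : Type*} [NormedAddCommGroup E] [NormedSpace ℝ E]
  {H : Type*} [TopologicalSpace H] {I : ModelWithCorners ℝ E H}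
  {N : Type*} [TopologicalSpace N] [ChartedSpace H N] [IsManifold I ∞ N]

theorem contMDiff_mvfderiv (f : ContMDiffMap I 𝓘(ℝ) N ℝ ∞) :
    ContMDiff I.tangent 𝓘(ℝ) ∞ fun v : TangentBundle I N => mvfderiv I f v.proj v.2 := by
  have h1 : ContMDiff I.tangent 𝓘(ℝ).tangent ∞ (tangentMap I 𝓘(ℝ) f) :=
    f.contMDiff.contMDiff_tangentMap (by simp)
  exact contMDiff_snd_tangentBundle_modelSpace ℝ 𝓘(ℝ) |>.comp h1

theorem contMDiff_pathDiffQuot (γ γ' : PathSpace I N) (V : PathTangentBundle I N)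
    (f : ContMDiffMap I 𝓘(ℝ) N ℝ ∞) (c : ℝ) :
    ContMDiff (𝓡∂ 1) 𝓘(ℝ) ∞ fun t : unitInterval =>
      (f (γ t) - f (γ' t)) / c - mvfderiv I f (V t).proj (V t).2 := by
  have h1 := f.contMDiff.comp γ.contMDiff
  have h2 := f.contMDiff.comp γ'.contMDiff
  have h3 := (contMDiff_mvfderiv f).comp V.contMDiff
  exact ((h1.sub h2).div_const c).sub h3

/-- The values of a velocity in the path space are the velocities of the transverse curves. -/
theorem HasPathVelocityWithinAt.hasVelocityWithinAt [FiniteDimensional ℝ E] [I.Boundaryless]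
    [T2Space N] {Γ : ℝ → PathSpace I N} {V : PathTangentBundle I N} {J : Set ℝ} {s : ℝ}
    (h : HasPathVelocityWithinAt Γ V J s) (t : unitInterval) :
    HasVelocityWithinAt (fun σ => Γ σ t) (V t) J s := by
  refine hasVelocityWithinAt_of_forall_contMDiffMap (h.1 t) fun f => ?_
  rw [hasDerivWithinAt_iff_tendsto_slope, tendsto_iff_norm_sub_tendsto_zero]
  refine squeeze_zero (fun _ => norm_nonneg _) (fun σ => ?_) (h.2 f)
  have h1 := abs_le_c1Norm (contMDiff_pathDiffQuot (Γ σ) (Γ s) V f (σ - s)) t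
  rwa [slope_def_field]

/-- A smooth family of paths has velocities in the path space. -/
theorem hasPathVelocityWithinAt_of_contMDiff {Γ : ℝ → PathSpace I N}
    (hΓ : ContMDiff (𝓘(ℝ).prod (𝓡∂ 1)) I ∞ fun p : ℝ × unitInterval => Γ p.1 p.2)
    {V : PathTangentBundle I N} {s : ℝ}
    (hV : ∀ t, HasVelocityWithinAt (fun σ => Γ σ t) (V t) Set.univ s) :
    HasPathVelocityWithinAt Γ V Set.univ s := by
  refine ⟨fun t => (hV t).proj_eq, fun f => ?_⟩
  let g : ℝ × ℝ → ℝ := fun z => f (Γ z.1 (Set.projIcc 0 1 zero_le_one z.2))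
  have hg : ContDiffOn ℝ ∞ g strip := by
    have h1 : ContMDiffOn (𝓘(ℝ).prod 𝓘(ℝ)) (𝓘(ℝ).prod (𝓡∂ 1)) ∞
        (Prod.map id (Set.projIcc (0 : ℝ) 1 zero_le_one)) strip :=
      contMDiffOn_id.prodMap contMDiffOn_projIcc
    have h2 := (f.contMDiff.comp hΓ).comp_contMDiffOn h1
    rw [← modelWithCornersSelf_prod, chartedSpaceSelf_prod] at h2
    exact h2.contDiffOn
  have hgt (σ : ℝ) (t : unitInterval) : g (σ, t) = f (Γ σ t) := by simp [g]
  have hder (t : unitInterval) :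
      fderivWithin ℝ g strip (s, t) (1, 0) = mvfderiv I f (V t).proj (V t).2 := by
    have h1 := (hV t).hasDerivWithinAt_comp (f.contMDiff.mdifferentiable (by simp) (Γ s t))
    have hmem : (s, (t : ℝ)) ∈ strip := ⟨Set.mem_univ _, t.2⟩
    have h2 := hasDerivAt_strip_fst
      (hg.differentiableOn (by simp) _ hmem).hasFDerivWithinAt t.2
    simp only [hgt] at h2
    exact h2.unique (hasDerivWithinAt_univ.1 h1)
  have h3 := tendsto_c1Norm_diffQuot hg s
  simp only [hgt, hder] at h3
  rwa [← Set.compl_eq_univ_sdiff]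

end PathVelocity

/-! ### The geodesic spray -/

section Spray

variable {E : Type*} [NormedAddCommGroup E] [NormedSpace ℝ E]
  {H : Type*} [TopologicalSpace H] {I : ModelWithCorners ℝ E H}
  {M : Type*} [TopologicalSpace M] [ChartedSpace H M] [IsManifold I ∞ M]

theorem hasVelocityWithinAt_mk_iff {c : ℝ → M} {J : Set ℝ} {s : ℝ} {w : TangentSpace I (c s)} :
    HasVelocityWithinAt c (⟨c s, w⟩ : TangentBundle I M) J s ↔
      HasMFDerivWithinAt 𝓘(ℝ) I c J s ((1 : ℝ →L[ℝ] ℝ).smulRight w) := by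
  refine ⟨?_, fun h => ⟨w, rfl, h⟩⟩
  rintro ⟨w', hw', h⟩
  obtain rfl : w = w' := by simpa using hw'
  exact h

namespace Connection

variable (φ : Connection I M)

/-- The geodesic spray of a connection: the vector field on `TM` whose integral curves are the
velocity curves of the geodesics. -/
def spray (v : TangentBundle I M) : TangentSpace I.tangent v := φ.lift v.2 v.2

theorem contMDiff_spray : ContMDiff I.tangent I.tangent.tangent ∞
    (fun v => (⟨v, φ.spray v⟩ : TangentBundle I.tangent (TangentBundle I M))) := by
  have h : ContMDiff I.tangent (I.prod 𝓘(ℝ, E × E)) ∞ (fun v : TangentBundle I M =>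
      (⟨v.proj, (v.2, v.2)⟩ :
        TotalSpace (E × E) (fun p : M => TangentSpace I p × TangentSpace I p))) := by
    intro v
    have hv := Bundle.contMDiffAt_totalSpace.1 (contMDiffAt_id (I := I.tangent) (n := ∞) (x := v))
    exact Bundle.contMDiffAt_totalSpace.2 ⟨hv.1, hv.2.prodMk_space hv.2⟩
  exact φ.contMDiff_lift.comp h

variable {φ}

theorem hasVelocityWithinAt_proj_of_isMIntegralCurveOn {u : ℝ → TangentBundle I M} {J : Set ℝ}
    (hu : IsMIntegralCurveOn u φ.spray J) {s : ℝ} (hs : s ∈ J) :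
    HasVelocityWithinAt (fun r => (u r).proj) (u s) J s := by
  refine hasVelocityWithinAt_mk_iff.2 ?_
  have h1 : MDifferentiableAt I.tangent I (fun v : TangentBundle I M => v.proj) (u s) :=
    (Bundle.contMDiff_proj (n := ∞) (TangentSpace I)).mdifferentiable (by simp) (u s)
  refine (h1.hasMFDerivAt.comp_hasMFDerivWithinAt s (hu s hs)).congr_mfderiv ?_
  ext
  change mfderiv I.tangent I (fun v : TangentBundle I M => v.proj) (u s)
    ((1 : ℝ) • φ.lift (u s).2 (u s).2) = (1 : ℝ) • (u s).2
  rw [one_smul, one_smul]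
  exact φ.mfderiv_proj_lift (u s).2 (u s).2

theorem induced_self_apply (V : PathTangentBundle I M) (t : unitInterval) :
    φ.induced (PathTangentBundle.toTangentSpace V) (PathTangentBundle.toTangentSpace V) t =
      ⟨V t, φ.spray (V t)⟩ := rfl

section Paths

variable {Φ : ℝ → TangentBundle I M → TangentBundle I M}

theorem exists_isPathGeodesicOn_univ
    (hΦ : ContMDiff (𝓘(ℝ).prod I.tangent) I.tangent ∞
      (fun z : ℝ × TangentBundle I M => Φ z.1 z.2))
    (hΦc : ∀ v, IsMIntegralCurve (fun s => Φ s v) φ.spray) (hΦ0 : ∀ v, Φ 0 v = v)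
    (V : PathTangentBundle I M) (s₀ : ℝ) :
    ∃ Γ : ℝ → PathSpace I M, φ.IsPathGeodesicOn Γ Set.univ ∧
      HasPathVelocityWithinAt Γ V Set.univ s₀ := by
  have hjoint : ContMDiff (𝓘(ℝ).prod (𝓡∂ 1)) I.tangent ∞
      fun p : ℝ × unitInterval => Φ (p.1 - s₀) (V p.2) :=
    hΦ.comp (((contDiff_id.sub contDiff_const).contMDiff.comp contMDiff_fst).prodMk
      (V.contMDiff.comp contMDiff_snd))
  let U : ℝ → PathTangentBundle I M := fun s =>
    ⟨fun t => Φ (s - s₀) (V t), hjoint.comp (contMDiff_const.prodMk contMDiff_id)⟩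
  have hcurve (t : unitInterval) : IsMIntegralCurve (fun s => U s t) φ.spray :=
    isMIntegralCurve_comp_sub.2 (hΦc (V t))
  let Γ : ℝ → PathSpace I M := fun s => PathTangentBundle.foot (U s)
  have hΓ (s : ℝ) : HasPathVelocityWithinAt Γ (U s) Set.univ s :=
    hasPathVelocityWithinAt_of_contMDiff
      ((Bundle.contMDiff_proj (TangentSpace I)).comp hjoint) fun t =>
        hasVelocityWithinAt_proj_of_isMIntegralCurveOn ((hcurve t).isMIntegralCurveOn _)
          (Set.mem_univ s)
  refine ⟨Γ, ⟨U, fun s _ => ⟨hΓ s, hasPathVelocityWithinAt_of_contMDiff hjoint fun t => ?_⟩⟩, ?_⟩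
  · rw [induced_self_apply]
    exact hasVelocityWithinAt_mk_iff.2 (hcurve t s).hasMFDerivWithinAt
  · have hU0 : U s₀ = V := ContMDiffMap.ext fun t => by
      change Φ (s₀ - s₀) (V t) = V t
      rw [sub_self, hΦ0]
    exact hU0 ▸ hΓ s₀

variable [FiniteDimensional ℝ E] [I.Boundaryless] [T2Space M]

theorem IsPathGeodesicOn.exists_velocity {Γ : ℝ → PathSpace I M} {J : Set ℝ}
    (h : φ.IsPathGeodesicOn Γ J) :
    ∃ U : ℝ → PathTangentBundle I M, (∀ s ∈ J, HasPathVelocityWithinAt Γ (U s) J s) ∧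
      ∀ t, IsMIntegralCurveOn (fun s => U s t) φ.spray J := by
  have : T2Space (TangentBundle I M) := t2Space_totalSpace (TangentSpace I)
  obtain ⟨U, hU⟩ := h
  refine ⟨U, fun s hs => (hU s hs).1, fun t s hs => ?_⟩
  have h1 := (hU s hs).2.hasVelocityWithinAt t
  rw [induced_self_apply] at h1
  exact hasVelocityWithinAt_mk_iff.1 h1

theorem isPathGeodesicOn_iff_forall_isGeodesicOn {J : Set ℝ} (hJ : UniqueDiffOn ℝ J)
    {Γ : ℝ → PathSpace I M} (hΓ : IsTwiceDifferentiablePathOn Γ J) :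
    φ.IsPathGeodesicOn Γ J ↔ ∀ t : unitInterval, φ.IsGeodesicOn (fun s => Γ s t) J := by
  have : T2Space (TangentBundle I M) := t2Space_totalSpace (TangentSpace I)
  constructor
  · intro h t
    obtain ⟨U, hU, hUt⟩ := h.exists_velocity
    exact ⟨fun s => U s t, fun s hs => ⟨(hU s hs).hasVelocityWithinAt t,
      hasVelocityWithinAt_mk_iff.2 (hUt t s hs)⟩⟩
  · intro h
    obtain ⟨U, A, hUA⟩ := hΓ
    refine ⟨U, fun s hs => ⟨(hUA s hs).1, ?_⟩⟩
    suffices A s = φ.induced (PathTangentBundle.toTangentSpace (U s))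
        (PathTangentBundle.toTangentSpace (U s)) from this ▸ (hUA s hs).2
    refine ContMDiffMap.ext fun t => ?_
    obtain ⟨u, hu⟩ := h t
    have huU : Set.EqOn (fun r => U r t) u J := fun r hr =>
      ((hUA r hr).1.hasVelocityWithinAt t).unique (hJ r hr) (hu r hr).1
    have h1 := (hu s hs).2.congr huU hs
    have h2 := ((hUA s hs).2.hasVelocityWithinAt t).unique (hJ s hs) h1
    have h3 : U s t = u s := huU hs
    rw [induced_self_apply, h2, h3]
    rfl

/-- On a geodesically complete manifold, the geodesic spray has a smooth global flow. -/
theorem GeodesicallyComplete.exists_flow (hφ : φ.GeodesicallyComplete) :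
    ∃ Φ : ℝ → TangentBundle I M → TangentBundle I M,
      ContMDiff (𝓘(ℝ).prod I.tangent) I.tangent ∞
        (fun z : ℝ × TangentBundle I M => Φ z.1 z.2) ∧
      (∀ v, IsMIntegralCurve (fun s => Φ s v) φ.spray) ∧ ∀ v, Φ 0 v = v := by
  have : T2Space (TangentBundle I M) := t2Space_totalSpace (TangentSpace I)
  have h (v : TangentBundle I M) :
      ∃ u : ℝ → TangentBundle I M, IsMIntegralCurve u φ.spray ∧ u 0 = v := by
    obtain ⟨c, ⟨u, hu⟩, hc⟩ := hφ v
    refine ⟨u, isMIntegralCurve_iff_isMIntegralCurveOn.2 fun s hs =>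
      hasVelocityWithinAt_mk_iff.1 (hu s hs).2, ?_⟩
    exact (hu 0 (Set.mem_univ _)).1.unique uniqueDiffWithinAt_univ hc
  choose Ψ hΨ hΨ0 using h
  exact ⟨fun s v => Ψ v s, contMDiff_flow (Φ := fun s v => Ψ v s) φ.contMDiff_spray hΨ hΨ0, hΨ, hΨ0⟩

theorem IsPathGeodesicOn.eq_flow_proj (hΦc : ∀ v, IsMIntegralCurve (fun s => Φ s v) φ.spray)
    (hΦ0 : ∀ v, Φ 0 v = v) {Γ : ℝ → PathSpace I M} {J : Set ℝ} (hJ : J.OrdConnected)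
    (h : φ.IsPathGeodesicOn Γ J) {V : PathTangentBundle I M} {s₀ : ℝ} (hs₀ : s₀ ∈ interior J)
    (hV : ∀ t, HasVelocityWithinAt (fun s => Γ s t) (V t) J s₀) {s : ℝ} (hs : s ∈ J)
    (t : unitInterval) : Γ s t = (Φ (s - s₀) (V t)).proj := by
  have : T2Space (TangentBundle I M) := t2Space_totalSpace (TangentSpace I)
  obtain ⟨U, hU, hUt⟩ := h.exists_velocity
  have h1 : U s₀ t = V t := ((hU s₀ (interior_subset hs₀)).hasVelocityWithinAt t).unique
    (uniqueDiffWithinAt_of_mem_nhds (mem_interior_iff_mem_nhds.1 hs₀)) (hV t)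
  have h2 : IsMIntegralCurve (fun s => Φ (s - s₀) (V t)) φ.spray :=
    isMIntegralCurve_comp_sub.2 (hΦc (V t))
  have h3 : U s t = Φ (s - s₀) (V t) := eqOn_of_isMIntegralCurveOn φ.contMDiff_spray hJ (hUt t)
    (h2.isMIntegralCurveOn J) hs₀ (by simp [h1, hΦ0]) hs
  rw [← h3]
  exact ((hU s hs).1 t).symm

end Paths

end Connection

end Spray

end PathGeometry

end

theorem mainTheorem2
    {E : Type*} [NormedAddCommGroup E] [NormedSpace ℝ E] [FiniteDimensional ℝ E]
    {H : Type*} [TopologicalSpace H] {I : ModelWithCorners ℝ E H} [I.Boundaryless]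
    {M : Type*} [TopologicalSpace M] [ChartedSpace H M] [IsManifold I ∞ M]
    [T2Space M] [SecondCountableTopology M]
    (φ : PathGeometry.Connection I M) :
    -- a curve in the path space is a geodesic iff all its transverse curves are geodesics in `M`
    (∀ (J : Set ℝ), J.OrdConnected → J.Nontrivial →
      ∀ Γ : ℝ → PathGeometry.PathSpace I M, PathGeometry.IsTwiceDifferentiablePathOn Γ J →
        (φ.IsPathGeodesicOn Γ J ↔ ∀ t : unitInterval, φ.IsGeodesicOn (fun s => Γ s t) J)) ∧
    -- completeness of `M` implies completeness of the path space
    (φ.GeodesicallyComplete →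
      φ.PathGeodesicallyComplete ∧
      -- the geodesic with given initial velocity is unique
      (∀ V : PathGeometry.PathTangentBundle I M, ∃! Γ : ℝ → PathGeometry.PathSpace I M,
        φ.IsPathGeodesicOn Γ Set.univ ∧
          PathGeometry.HasPathVelocityWithinAt Γ V Set.univ 0) ∧
      -- every geodesic defined on an interval extends uniquely to all of `ℝ`
      (∀ (J : Set ℝ), J.OrdConnected → J.Nontrivial →
        ∀ Γ : ℝ → PathGeometry.PathSpace I M, φ.IsPathGeodesicOn Γ J →
          ∃! Γ' : ℝ → PathGeometry.PathSpace I M,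
            φ.IsPathGeodesicOn Γ' Set.univ ∧ Set.EqOn Γ' Γ J) ∧
      -- geodesics are smooth in both variables jointly
      (∀ Γ : ℝ → PathGeometry.PathSpace I M, φ.IsPathGeodesicOn Γ Set.univ →
        ContMDiff (𝓘(ℝ).prod (𝓡∂ 1)) I ∞ fun p : ℝ × unitInterval => Γ p.1 p.2)) := by
  refine ⟨fun J hJ hJ' Γ hΓ =>
    PathGeometry.Connection.isPathGeodesicOn_iff_forall_isGeodesicOn
      (PathGeometry.uniqueDiffOn_of_ordConnected hJ hJ') hΓ, fun hφ => ?_⟩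
  obtain ⟨Φ, hΦ, hΦc, hΦ0⟩ := hφ.exists_flow
  have huniv (s : ℝ) : s ∈ interior (Set.univ : Set ℝ) := by simp
  have hext {Γ Γ' : ℝ → PathGeometry.PathSpace I M} {V : PathGeometry.PathTangentBundle I M}
      {s₀ : ℝ} (h : φ.IsPathGeodesicOn Γ Set.univ) (h' : φ.IsPathGeodesicOn Γ' Set.univ)
      (hV : ∀ t, PathGeometry.HasVelocityWithinAt (fun s => Γ s t) (V t) Set.univ s₀)
      (hV' : ∀ t, PathGeometry.HasVelocityWithinAt (fun s => Γ' s t) (V t) Set.univ s₀) :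
      Γ = Γ' := by
    ext s t
    rw [h.eq_flow_proj hΦc hΦ0 Set.ordConnected_univ (huniv s₀) hV (Set.mem_univ s) t,
      h'.eq_flow_proj hΦc hΦ0 Set.ordConnected_univ (huniv s₀) hV' (Set.mem_univ s) t]
  have hex := PathGeometry.Connection.exists_isPathGeodesicOn_univ hΦ hΦc hΦ0
  refine ⟨fun V => hex V 0, fun V => ?_, fun J hJ hJ' Γ hΓ => ?_, fun Γ hΓ => ?_⟩
  · obtain ⟨Γ, hΓ, hV⟩ := hex V 0
    exact ⟨Γ, ⟨hΓ, hV⟩, fun Γ' h' =>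
      hext h'.1 hΓ h'.2.hasVelocityWithinAt hV.hasVelocityWithinAt⟩
  · obtain ⟨U, hU, -⟩ := hΓ.exists_velocity
    obtain ⟨s₀, hs₀⟩ := PathGeometry.interior_nonempty_of_ordConnected hJ hJ'
    have hs₀J := interior_subset hs₀
    obtain ⟨Γ', hΓ', hV⟩ := hex (U s₀) s₀
    refine ⟨Γ', ⟨hΓ', fun s hs => ?_⟩, fun Γ'' h'' => ?_⟩
    · ext t
      rw [hΓ'.eq_flow_proj hΦc hΦ0 Set.ordConnected_univ (huniv s₀) hV.hasVelocityWithinAt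
        (Set.mem_univ s) t,
        hΓ.eq_flow_proj hΦc hΦ0 hJ hs₀ (hU s₀ hs₀J).hasVelocityWithinAt hs t]
    · obtain ⟨U'', hU'', -⟩ := h''.1.exists_velocity
      have hvel := (hU'' s₀ (Set.mem_univ _)).hasVelocityWithinAt
      have hUV (t : unitInterval) : U'' s₀ t = U s₀ t := by
        have hcongr : Set.EqOn (fun s => Γ s t) (fun s => Γ'' s t) J := fun s hs => by
          simp only [h''.2 hs]
        exact (((hvel t).mono (Set.subset_univ J)).congr hcongr hs₀J).unique
          (PathGeometry.uniqueDiffOn_of_ordConnected hJ hJ' s₀ hs₀J)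
          ((hU s₀ hs₀J).hasVelocityWithinAt t)
      exact hext h''.1 hΓ' (fun t => hUV t ▸ hvel t) hV.hasVelocityWithinAt
  · obtain ⟨U, hU, -⟩ := hΓ.exists_velocity
    have heq : (fun p : ℝ × unitInterval => Γ p.1 p.2) = fun p => (Φ (p.1 - 0) (U 0 p.2)).proj := by
      ext p
      exact hΓ.eq_flow_proj hΦc hΦ0 Set.ordConnected_univ (huniv 0)
        (hU 0 (Set.mem_univ _)).hasVelocityWithinAt (Set.mem_univ p.1) p.2
    rw [heq]
    simp only [sub_zero]
    exact (Bundle.contMDiff_proj (TangentSpace I)).comp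
      (hΦ.comp (contMDiff_fst.prodMk ((U 0).contMDiff.comp contMDiff_snd)))
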